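/- **Model.** A finite set $V$ of agents is joined by an undirected graph of strong links and an undirected graph of weak links; $N(i)$ is the set of strong neighbours of $i$, and $d_{\max}$, $d_{\min}$ are the maximum and minimum of $|N(i)|$ (with $1/0=\infty$). The strong graph is called regular if $d_{\max}=d_{\min}$. At each time $t\ge 0$ agent $i$ chooses $a_i(t)\in\{0,1\}$; all agents start with Action 0. Payoff shocks arrive by a Poisson clock of rate $\lambda\ge 0$; after each shock (and initially) a fair coin decides which action has the higher material payoff until the next shock, the gap being 1. The payoff of agent $i$ from action $x$ is its material payoff plus $\tau\,|\{j\in N(i): a_j=x\}|$, where $\tau\ge 0$. By a Poisson clock of rate $\epsilon>0$ a uniformly chosen agent trembles, i.e. momentarily plays the opposite of her intended action. By a Poisson clock of rate $\gamma\ge0$ a uniformly chosen link among the dormant weak links between agents playing different actions is activated; it then stays inactive until its own Poisson clock of rate $\phi\ge0$ ticks. All these random elements are independent. Agents see the actions and trembles of themselves and their strong neighbours and the activations of their own weak links. A time of information arrival for $i$ is one at which $i$ trembles, a weak link of $i$ is activated, or some strong neighbour is seen playing a different action; the agent then learns which action has the higher material payoff. Otherwise her belief at time $t$ is the conditional probability,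 given what she observed before $t$, that Action 1 has the higher material payoff. A profile $b\in\{0,1\}^V$ is a (pure-strategy) *Bayesian-Nash equilibrium (BNE)* profile for time $t$, after a given history and with profile $c$ played just before $t$, if every $b_i$ maximises the expected payoff of $i$ given her belief at $t$ and the actions $b_j$, $j\ne i$, and if $b$ is reached from $c$ by (finitely many, instantaneous) changes of action of single agents, each strictly profitable to the agent who changes given her belief and the current actions of the others; information that arrives in the course of these changes is taken into account. A *BNE play* is a piecewise constant, right-continuous process $a(t)$ that starts with Action 0 for all agents and is such that, almost surely, for all $t>0$, $a(t)$ is a BNE profile for time $t$ with $a(t^-)$ played just before. **Theorem.** 1. A BNE always exists: after every history of play Bayesian beliefs exist, and for every time $t$, every state of the world and every profile played just before $t$, there is a BNE profile for time $t$. 2. Suppose $\tau\le 1/d_{\max}$. In every BNE profile, for every time and after every history, any two agents joined by a path of strong links play the same action. Consequently, in every BNE play, almost surely $a_i(t)=a_j(t)$ for all times $t\ge 0$ and all agents $i,j$ joined by a path of strong links. 3. Suppose $\tau>1/d_{\min}$. Then a BNE play exists, and in every BNE play, almost surely, all agents play Action 0 at all times. In particular, if the strong graph is also regular, then almost surely $a_i(t)=a_j(t)$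 for all $i,j\in V$ and all $t\ge 0$. -/

import Mathlib

open MeasureTheory ProbabilityTheory Filter Topology
open scoped NNReal ENNReal

/-! ### Primitives: network, clocks, payoff shocks -/

/-- The Poisson clocks of the economy: payoff shocks, weak-link activations, trembles, and, for
every weak link `e`, the clock that turns `e` from inactive back to dormant. -/
inductive Clock (V : Type*)
  | shock
  | activation
  | tremble
  | recovery (e : Sym2 V)

/-- Labels of the elementary random variables of the economy. -/
inductive Source (V : Type*)
  | gap (c : Clock V) (k : ℕ)
  | coin (k : ℕ)
  | trembler (k : ℕ)
  | priority (k : ℕ) (e : Sym2 V)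

/-- The sigma-algebra generated by one elementary random variable. -/
@[reducible] def sourceSigma {V Ω : Type*} (gap : Clock V → ℕ → Ω → ℝ) (coin : ℕ → Ω → Fin 2)
    (trembler : ℕ → Ω → V) (priority : ℕ → Sym2 V → Ω → ℝ) : Source V → MeasurableSpace Ω
  | .gap c k => MeasurableSpace.comap (gap c k) inferInstance
  | .coin k => MeasurableSpace.comap (coin k) inferInstance
  | .trembler k => MeasurableSpace.comap (trembler k) ⊤
  | .priority k e => MeasurableSpace.comap (priority k e) inferInstance

/-- The environment of the game: the network of strong and weak links, the strength `τ` of the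
local network payoff, the rates of the Poisson clocks, and the (independent) random primitives.
* `gap c k`: standard exponential variables; divided by the rate of the clock `c` they are the
  waiting times between its ticks;
* `coin k`: the action with the higher material payoff on `(T_k, T_{k+1}]`, a fair coin;
* `trembler k`: the agent who trembles at the `k`-th tick of the tremble clock, uniform;
* `priority k e`: independent uniform priorities of the links; at the `k`-th tick of the activation
  clock the eligible link of least priority is activated, i.e. a uniformly random eligible link. -/
structure Environment (V : Type*) [Fintype V] {Ω : Type*} [MeasurableSpace Ω]
    (P : Measure Ω) where
  strong : SimpleGraph V
  weak : SimpleGraph V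
  /-- strength of the local network payoff -/
  τ : ℝ≥0
  /-- rate of payoff shocks -/
  shockRate : ℝ≥0
  /-- rate of weak-link activation -/
  activationRate : ℝ≥0
  /-- rate at which an inactive weak link becomes dormant again -/
  recoveryRate : ℝ≥0
  /-- rate of trembles -/
  trembleRate : ℝ≥0
  trembleRate_pos : 0 < trembleRate
  gap : Clock V → ℕ → Ω → ℝ
  coin : ℕ → Ω → Fin 2
  trembler : ℕ → Ω → V
  priority : ℕ → Sym2 V → Ω → ℝ
  measurable_gap : ∀ c k, Measurable (gap c k)
  measurable_coin : ∀ k, Measurable (coin k)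
  measurable_trembler : ∀ k i, MeasurableSet {ω | trembler k ω = i}
  measurable_priority : ∀ k e, Measurable (priority k e)
  law_gap : ∀ c k, P.map (gap c k) = expMeasure 1
  law_coin : ∀ k x, P {ω | coin k ω = x} = 1 / 2
  law_trembler : ∀ k i, P {ω | trembler k ω = i} = 1 / (Fintype.card V : ℝ≥0∞)
  law_priority : ∀ k e, P.map (priority k e) = volume.restrict (Set.Icc (0 : ℝ) 1)
  indep : iIndep (sourceSigma gap coin trembler priority) P

namespace Environment

variable {V : Type*} [Fintype V] {Ω : Type*} [MeasurableSpace Ω] {P : Measure Ω}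

/-- Rate of a clock. -/
def rate (E : Environment V P) : Clock V → ℝ≥0
  | .shock => E.shockRate
  | .activation => E.activationRate
  | .tremble => E.trembleRate
  | .recovery _ => E.recoveryRate

/-- Time of the tick number `k = 0, 1, 2, …` of a clock; it is `∞` (never) if the rate is zero. -/
noncomputable def tick (E : Environment V P) (c : Clock V) (k : ℕ) (ω : Ω) : ℝ≥0∞ :=
  (∑ j ∈ Finset.range (k + 1), ENNReal.ofReal (E.gap c j ω)) / (E.rate c : ℝ≥0∞)

/-- The action with the higher material payoff at time `t⁺`. Rewards are constant on the intervals
`(T_k, T_{k+1}]` between payoff shocks, so this is `coin k` if exactly `k` shocks have occurred up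
to and including time `t`. -/
noncomputable def better (E : Environment V P) (t : ℝ≥0) (ω : Ω) : Fin 2 :=
  E.coin (Set.ncard {k : ℕ | E.tick .shock k ω ≤ (t : ℝ≥0∞)}) ω

/-- Agent `i` trembles at time `t`. -/
def Trembles (E : Environment V P) (t : ℝ≥0) (ω : Ω) (i : V) : Prop :=
  ∃ k, E.tick .tremble k ω = (t : ℝ≥0∞) ∧ E.trembler k ω = i

open Classical in
/-- Maximum degree with respect to strong links. -/
noncomputable def dMax (E : Environment V P) : ℕ := E.strong.maxDegree

open Classical in
/-- Minimum degree with respect to strong links. -/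
noncomputable def dMin (E : Environment V P) : ℕ := E.strong.minDegree

/-! ### Payoffs -/

/-- Material payoff of action `x` when `y` is the better action. Only the difference between the
two payoffs matters; it is one, and the lower payoff is normalised to zero. -/
def material (y x : Fin 2) : ℝ := if x = y then 1 else 0

open Classical in
/-- Number of strong neighbours of `i` playing `x` in the profile `a`. -/
noncomputable def agreement (E : Environment V P) (a : V → Fin 2) (i : V) (x : Fin 2) : ℝ :=
  ∑ j : V, if E.strong.Adj i j ∧ a j = x then 1 else 0

/-- Expected payoff of agent `i` from action `x`, given the actions `a` of the other agents, if `i`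
attaches probability `p` to Action `1` having the higher material payoff. -/
noncomputable def expectedPayoff (E : Environment V P) (p : ℝ) (a : V → Fin 2) (i : V)
    (x : Fin 2) : ℝ :=
  (p * material 1 x + (1 - p) * material 0 x) + E.τ * E.agreement a i x

end Environment

/-! ### Play, information and beliefs -/

/-- A play of the game: the profile of intended actions at each time, the set of weak links that
are activated at each time, and the set of agents for whom that time is a time of information
arrival. -/
structure Play (V Ω : Type*) where
  act : ℝ≥0 → Ω → V → Fin 2
  links : ℝ≥0 → Ω → Set (Sym2 V)
  news : ℝ≥0 → Ω → Set V

/-- The things an agent may observe at an instant: that `j` intends action `x`, that `j` trembles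
(plays the opposite of the intended action), that the weak link `e` is activated, and that `x` is
the action with the higher material payoff. -/
inductive Signal (V : Type*)
  | action (j : V) (x : Fin 2)
  | tremble (j : V)
  | activation (e : Sym2 V)
  | payoff (x : Fin 2)

section Game

variable {V : Type*} [Fintype V] {Ω : Type*} [MeasurableSpace Ω] {P : Measure Ω}

/-- Agent `i` receives the signal at time `s`. She sees the actions of her strong neighbours and
her own, and the activations of her own weak links. At a time of information arrival, and only
then, she can compare the payoffs of the two actions, which reveals the better one. -/
def Observes (E : Environment V P) (X : Play V Ω) (i : V) : Signal V → ℝ≥0 → Ω → Prop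
  | .action j x, s, ω => (j = i ∨ E.strong.Adj i j) ∧ X.act s ω j = x
  | .tremble j, s, ω => (j = i ∨ E.strong.Adj i j) ∧ E.Trembles s ω j
  | .activation e, s, ω => i ∈ e ∧ e ∈ X.links s ω
  | .payoff x, s, ω => i ∈ X.news s ω ∧ E.better s ω = x

/-- The information set of agent `i` on entering time `t`: generated by the events that a given
signal is received during a given time window before `t`. -/
@[reducible] def info (E : Environment V P) (X : Play V Ω) (i : V) (t : ℝ≥0) : MeasurableSpace Ω :=
  MeasurableSpace.generateFrom
    {F | ∃ (o : Signal V) (u v : ℝ≥0), v ≤ t ∧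
      F = {ω | ∃ s, u ≤ s ∧ s < v ∧ Observes E X i o s ω}}

/-- The observations generated by the play are events of the underlying probability space. -/
def IsMeasurablePlay (E : Environment V P) (X : Play V Ω) : Prop :=
  ∀ i t, info E X i t ≤ (inferInstance : MeasurableSpace Ω)

/-- `q i t` is the belief, by Bayes' rule, that agent `i` holds on entering time `t`: a version of
the conditional probability, given her information, that Action `1` is the better one. -/
structure IsBayesBelief (E : Environment V P) (X : Play V Ω) (q : V → ℝ≥0 → Ω → ℝ) : Prop where
  mem_Icc : ∀ i t ω, q i t ω ∈ Set.Icc (0 : ℝ) 1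
  bayes : ∀ i t, q i t =ᵐ[P]
    P[Set.indicator {ω | E.better t ω = 1} (fun _ => (1 : ℝ)) | info E X i t]

/-- The weak link `e` is dormant at time `t`: since its last activation, if any, its recovery clock
has ticked. -/
def Dormant (E : Environment V P) (X : Play V Ω) (t : ℝ≥0) (ω : Ω) (e : Sym2 V) : Prop :=
  e ∈ E.weak.edgeSet ∧ ∀ s < t, e ∈ X.links s ω →
    ∃ k, (s : ℝ≥0∞) < E.tick (.recovery e) k ω ∧ E.tick (.recovery e) k ω < (t : ℝ≥0∞)

/-- The links that may be activated at time `t` while the profile `c` is played: the dormant links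
between agents playing different actions. -/
def eligible (E : Environment V P) (X : Play V Ω) (t : ℝ≥0) (ω : Ω) (c : V → Fin 2) :
    Set (Sym2 V) :=
  {e | Dormant E X t ω e ∧ ∃ i j, e = s(i, j) ∧ c i ≠ c j}

/-- The links activated at time `t` while the profile `c` is played: if the activation clock ticks,
a uniformly random eligible link. -/
def activated (E : Environment V P) (X : Play V Ω) (t : ℝ≥0) (ω : Ω) (c : V → Fin 2) :
    Set (Sym2 V) :=
  {e | e ∈ eligible E X t ω c ∧ ∃ k, E.tick .activation k ω = (t : ℝ≥0∞) ∧
    ∀ e' ∈ eligible E X t ω c, e' ≠ e → E.priority k e ω < E.priority k e' ω}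

/-- The agents having a strong neighbour who plays a different action. -/
def disagree (E : Environment V P) (a : V → Fin 2) : Set V :=
  {i | ∃ j, E.strong.Adj i j ∧ a i ≠ a j}

open Classical in
/-- The realised actions at time `t` if `c` is intended: a trembling agent plays the opposite. -/
noncomputable def realised (E : Environment V P) (t : ℝ≥0) (ω : Ω) (c : V → Fin 2) : V → Fin 2 :=
  fun i => if E.Trembles t ω i then 1 - c i else c i

/-- The agents for whom information arrives at time `t` while `c` is played: those who tremble, the
ends of an activated weak link, and those who see a strong neighbour play a different action. -/
def arrivals (E : Environment V P) (X : Play V Ω) (t : ℝ≥0) (ω : Ω) (c : V → Fin 2) : Set V :=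
  {i | E.Trembles t ω i} ∪ {i | ∃ e ∈ activated E X t ω c, i ∈ e} ∪
    disagree E c ∪ disagree E (realised E t ω c)

open Classical in
/-- Belief of agent `i` at time `t` if `K` is the set of agents for whom information has arrived at
`t`: such an agent knows which action is better; any other agent keeps her belief `q i t`. -/
noncomputable def belief (E : Environment V P) (q : V → ℝ≥0 → Ω → ℝ) (t : ℝ≥0) (ω : Ω)
    (K : Set V) (i : V) : ℝ :=
  if i ∈ K then (if E.better t ω = 1 then 1 else 0) else q i t ω

/-- Every agent maximises her expected payoff, given the actions of the others and her belief. -/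
def MutualBestReply (E : Environment V P) (q : V → ℝ≥0 → Ω → ℝ) (t : ℝ≥0) (ω : Ω)
    (b : V → Fin 2) (K : Set V) : Prop :=
  ∀ i x, E.expectedPayoff (belief E q t ω K i) b i x ≤
    E.expectedPayoff (belief E q t ω K i) b i (b i)

open Classical in
/-- One adjustment within the instant `t`. The state is the current profile and the set of agents
for whom information has arrived. Strong links being instantaneous, one agent who strictly gains by
it changes her action, and whoever then sees a neighbour playing differently becomes informed. -/
def Adjust (E : Environment V P) (q : V → ℝ≥0 → Ω → ℝ) (t : ℝ≥0) (ω : Ω)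
    (x y : (V → Fin 2) × Set V) : Prop :=
  ∃ i, E.expectedPayoff (belief E q t ω x.2 i) x.1 i (x.1 i) <
      E.expectedPayoff (belief E q t ω x.2 i) x.1 i (1 - x.1 i) ∧
    y.1 = Function.update x.1 i (1 - x.1 i) ∧ y.2 = x.2 ∪ disagree E y.1

/-- `b` is an equilibrium profile at time `t` after the history `X` if `c` was played just before,
and `K` is the set of agents for whom `t` is a time of information arrival: starting from `c`,
agents adjust only when they strictly gain, and in the end everybody is at an optimum. -/
def IsBNEWith (E : Environment V P) (X : Play V Ω) (q : V → ℝ≥0 → Ω → ℝ) (t : ℝ≥0) (ω : Ω)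
    (c b : V → Fin 2) (K : Set V) : Prop :=
  Relation.ReflTransGen (Adjust E q t ω) (c, arrivals E X t ω c) (b, K) ∧
    MutualBestReply E q t ω b K

/-- `b` is a (pure-strategy) Bayesian-Nash equilibrium profile at time `t` after the history `X` if
`c` was played just before. Only the part of `X` before time `t` matters. -/
def IsBNE (E : Environment V P) (X : Play V Ω) (q : V → ℝ≥0 → Ω → ℝ) (t : ℝ≥0) (ω : Ω)
    (c b : V → Fin 2) : Prop :=
  ∃ K, IsBNEWith E X q t ω c b K

/-- The play starts with Action `0` everywhere and is in Bayesian-Nash equilibrium at all times.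
Paths are right-continuous step functions with left limits. -/
structure IsEquilibriumPlay (E : Environment V P) (X : Play V Ω) (q : V → ℝ≥0 → Ω → ℝ) :
    Prop where
  measurable : IsMeasurablePlay E X
  bayes : IsBayesBelief E X q
  initial : ∀ᵐ ω ∂P, (∀ i, X.act 0 ω i = 0) ∧ X.links 0 ω = ∅ ∧ X.news 0 ω = ∅
  right_cont : ∀ᵐ ω ∂P, ∀ t, ∀ᶠ s in 𝓝[>] t, X.act s ω = X.act t ω
  equilibrium : ∀ᵐ ω ∂P, ∀ t > 0, ∃ c : V → Fin 2, (∀ᶠ s in 𝓝[<] t, X.act s ω = c) ∧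
    X.links t ω = activated E X t ω c ∧ IsBNEWith E X q t ω c (X.act t ω) (X.news t ω)

end Game

/-!
Fix an instant and the set `K` of informed agents. The adjustment game is then a potential game:
the sum of the agents' expected material payoffs plus `τ` times the number of strong links whose
ends agree changes, when one agent switches, by exactly her gain (`potential_update`). Since `K`
can only grow, the pair (size of `K`, potential) increases lexicographically along adjustments. As
there are finitely many states, a maximal reachable one exists, and no agent can gain in it
(`exists_isBNE`). Bayesian beliefs are conditional expectations truncated to `[0, 1]`.

Along adjustments, agents who see a neighbour act differently are always informed
(`disagree_subset_of_reflTransGen`). So if two neighbours end up playing different actions, both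
know the better one. At least one neighbour of the agent who plays the worse action already plays
the better one, so switching costs her at most `τ * (dMax - 2)` and earns her `1`. With
`τ * dMax ≤ 1` she is not at an optimum (`IsBNE.eq_of_adj`).

If `τ * dMin > 1`, then Action `1` is never profitable for an agent all of whose neighbours play
Action `0`, whatever her belief. The profile `0` therefore admits no adjustment, so it is the only
equilibrium profile reachable from itself, and an infimum argument along the right-continuous paths
shows that it is never left (`IsEquilibriumPlay.ae_act_eq_zero`). Conversely the constant play `0`
is an equilibrium play; the point is that its observations are events: an agent gets news exactly
when she or a strong neighbour trembles, and the tremble times and the number of shocks before them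
are random variables (`isMeasurablePlay_zeroPlay`).
-/

section Auxiliary

variable {V : Type*} [Fintype V] {Ω : Type*} [MeasurableSpace Ω] {P : Measure Ω}

/-! ### Bayesian beliefs -/

theorem exists_isBayesBelief [IsProbabilityMeasure P] (E : Environment V P) (X : Play V Ω)
    (hX : IsMeasurablePlay E X) : ∃ q : V → ℝ≥0 → Ω → ℝ, IsBayesBelief E X q := by
  refine ⟨fun i t ω => max 0 (min 1
    ((P[Set.indicator {ω | E.better t ω = 1} (fun _ => (1 : ℝ)) | info E X i t]) ω)), ?_, ?_⟩
  · intro i t ω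
    exact ⟨le_max_left _ _, max_le zero_le_one (min_le_left _ _)⟩
  · intro i t
    have h0 : 0 ≤ᵐ[P] P[Set.indicator {ω | E.better t ω = 1} (fun _ => (1 : ℝ)) | info E X i t] :=
      condExp_nonneg (Eventually.of_forall fun ω => Set.indicator_nonneg (fun _ _ => zero_le_one) ω)
    have h1 : P[Set.indicator {ω | E.better t ω = 1} (fun _ => (1 : ℝ)) | info E X i t]
        ≤ᵐ[P] fun _ => (1 : ℝ) := by
      by_cases hint : Integrable (Set.indicator {ω | E.better t ω = 1} (fun _ => (1 : ℝ))) P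
      · have h := condExp_mono (m := info E X i t) hint (integrable_const (1 : ℝ))
          (Eventually.of_forall fun ω =>
            Set.indicator_le_self' (s := {ω | E.better t ω = 1}) (fun _ _ => zero_le_one) ω)
        rwa [condExp_const (hX i t)] at h
      · rw [condExp_of_not_integrable hint]
        exact Eventually.of_forall fun _ => zero_le_one
    filter_upwards [h0, h1] with ω h0 h1
    rw [min_eq_right h1]
    exact max_eq_right (show (0 : ℝ) ≤ _ from h0)

theorem belief_mem_Icc {E : Environment V P} {X : Play V Ω} {q : V → ℝ≥0 → Ω → ℝ}
    (hq : IsBayesBelief E X q) (t : ℝ≥0) (ω : Ω) (K : Set V) (i : V) :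
    belief E q t ω K i ∈ Set.Icc (0 : ℝ) 1 := by
  unfold belief
  split_ifs
  · simp
  · simp
  · exact hq.mem_Icc i t ω

/-! ### The potential of the adjustment game -/

theorem Fin.eq_zero_or_one_of_two (x : Fin 2) : x = 0 ∨ x = 1 := by
  revert x; decide

theorem Fin.eq_one_sub_of_ne {x y : Fin 2} (h : x ≠ y) : x = 1 - y := by
  revert x y; decide

namespace Environment

open Classical in
theorem agreement_zero_add_one (E : Environment V P) (a : V → Fin 2) (i : V) :
    E.agreement a i 0 + E.agreement a i 1 = E.strong.degree i := by
  rw [← SimpleGraph.card_neighborFinset_eq_degree, SimpleGraph.neighborFinset_eq_filter,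
    Finset.card_filter, agreement, agreement, ← Finset.sum_add_distrib]
  push_cast
  refine Finset.sum_congr rfl fun j _ => ?_
  by_cases h : E.strong.Adj i j
  · obtain h' | h' := Fin.eq_zero_or_one_of_two (a j)
    all_goals simp [h, h']
  · simp [h]

theorem agreement_nonneg (E : Environment V P) (a : V → Fin 2) (i : V) (x : Fin 2) :
    0 ≤ E.agreement a i x :=
  Finset.sum_nonneg fun _ _ => by split_ifs <;> norm_num

theorem one_le_agreement (E : Environment V P) {a : V → Fin 2} {i j : V} (h : E.strong.Adj i j) :
    1 ≤ E.agreement a i (a j) := by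
  classical
  have := Finset.single_le_sum (f := fun k => if E.strong.Adj i k ∧ a k = a j then (1 : ℝ) else 0)
    (fun _ _ => by split_ifs <;> norm_num) (Finset.mem_univ j)
  simpa [h, agreement] using this

/-- The potential of the adjustment game when agent `i` believes with probability `p i` that
Action `1` is better. The second sum counts every strong link with agreeing ends twice. -/
noncomputable def potential (E : Environment V P) (p : V → ℝ) (a : V → Fin 2) : ℝ :=
  ∑ i, (p i * material 1 (a i) + (1 - p i) * material 0 (a i)) +
    E.τ / 2 * ∑ i, E.agreement a i (a i)

open Classical in
/-- Switching one agent changes the links at that agent only, each of them counted twice. -/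
theorem sum_agreement_update (E : Environment V P) (a : V → Fin 2) (i : V) (x : Fin 2) :
    ∑ j, E.agreement (Function.update a i x) j (Function.update a i x j) -
      ∑ j, E.agreement a j (a j) = 2 * (E.agreement a i x - E.agreement a i (a i)) := by
  set b := Function.update a i x with hb
  set f : V → V → ℝ := fun j k => (if E.strong.Adj j k ∧ b k = b j then 1 else 0) -
    (if E.strong.Adj j k ∧ a k = a j then 1 else 0) with hf
  have hsymm : ∀ j k, f j k = f k j := fun j k => by
    simp only [hf, E.strong.adj_comm j k, eq_comm (a := b k), eq_comm (a := a k)]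
  have hfi : ∑ k, f i k = E.agreement a i x - E.agreement a i (a i) := by
    rw [agreement, agreement, ← Finset.sum_sub_distrib]
    refine Finset.sum_congr rfl fun k _ => ?_
    by_cases hk : k = i
    · subst hk; simp [hf]
    · simp [hf, hb, Function.update_of_ne hk]
  have hsplit : ∀ j k, f j k = (if j = i then f i k else 0) + (if k = i then f i j else 0) := by
    intro j k
    by_cases hj : j = i <;> by_cases hk : k = i
    · subst hj; subst hk; simp [hf]
    · simp [hj, hk]
    · simp [hj, hk, hsymm i j]
    · simp [hf, hb, hj, hk]
  have : ∑ j, ∑ k, f j k = ∑ k, f i k + ∑ j, f i j := by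
    rw [Finset.sum_congr rfl fun j _ => Finset.sum_congr rfl fun k _ => hsplit j k]
    simp only [Finset.sum_add_distrib]
    rw [Finset.sum_comm]
    simp
  rw [← hfi, two_mul, ← this, ← Finset.sum_sub_distrib]
  refine Finset.sum_congr rfl fun j _ => ?_
  rw [agreement, agreement, ← Finset.sum_sub_distrib]

open Classical in
theorem potential_update (E : Environment V P) (p : V → ℝ) (a : V → Fin 2) (i : V) (x : Fin 2) :
    E.potential p (Function.update a i x) - E.potential p a =
      E.expectedPayoff (p i) a i x - E.expectedPayoff (p i) a i (a i) := by
  have hmat : ∑ j, (p j * material 1 (Function.update a i x j) +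
        (1 - p j) * material 0 (Function.update a i x j)) -
      ∑ j, (p j * material 1 (a j) + (1 - p j) * material 0 (a j)) =
      (p i * material 1 x + (1 - p i) * material 0 x) -
        (p i * material 1 (a i) + (1 - p i) * material 0 (a i)) := by
    rw [← Finset.sum_sub_distrib, Finset.sum_eq_single i]
    · simp
    · intro j _ hj
      simp [Function.update_of_ne hj]
    · simp
  have hagr := E.sum_agreement_update a i x
  simp only [potential, expectedPayoff]
  linear_combination hmat + (E.τ : ℝ) / 2 * hagr

end Environment

/-! ### Existence of equilibrium profiles -/

/-- The quantity that adjustments increase: the number of informed agents and, as long as this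
number stays the same, the potential. -/
noncomputable def adjustmentRank (E : Environment V P) (q : V → ℝ≥0 → Ω → ℝ) (t : ℝ≥0) (ω : Ω)
    (x : (V → Fin 2) × Set V) : ℕ ×ₗ ℝ :=
  toLex (x.2.ncard, E.potential (belief E q t ω x.2) x.1)

theorem Adjust.adjustmentRank_lt {E : Environment V P} {q : V → ℝ≥0 → Ω → ℝ} {t : ℝ≥0} {ω : Ω}
    {x y : (V → Fin 2) × Set V} (h : Adjust E q t ω x y) :
    adjustmentRank E q t ω x < adjustmentRank E q t ω y := by
  obtain ⟨i, hgain, h1, h2⟩ := h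
  have hsub : x.2 ⊆ y.2 := h2 ▸ Set.subset_union_left
  rw [adjustmentRank, adjustmentRank, Prod.Lex.toLex_lt_toLex]
  rcases hsub.eq_or_ssubset with heq | hss
  · refine Or.inr ⟨congrArg Set.ncard heq, ?_⟩
    have := E.potential_update (belief E q t ω x.2) x.1 i (1 - x.1 i)
    simp only [← heq, h1]
    convert sub_pos.1 (this ▸ sub_pos.2 hgain)
  · exact Or.inl (Set.ncard_lt_ncard hss (Set.toFinite _))

theorem exists_isBNE (E : Environment V P) (X : Play V Ω) (q : V → ℝ≥0 → Ω → ℝ) (t : ℝ≥0)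
    (ω : Ω) (c : V → Fin 2) : ∃ b, IsBNE E X q t ω c b := by
  obtain ⟨⟨b, K⟩, hb, hmax⟩ := Set.exists_max_image
    {y | Relation.ReflTransGen (Adjust E q t ω) (c, arrivals E X t ω c) y}
    (adjustmentRank E q t ω) (Set.toFinite _) ⟨_, Relation.ReflTransGen.refl⟩
  refine ⟨b, K, hb, fun i x => ?_⟩
  classical
  by_cases hx : x = b i
  · rw [hx]
  · rw [Fin.eq_one_sub_of_ne hx]
    by_contra! hlt
    have hadj : Adjust E q t ω (b, K) (Function.update b i (1 - b i),
        K ∪ disagree E (Function.update b i (1 - b i))) := ⟨i, hlt, rfl, rfl⟩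
    exact (hmax _ (hb.tail hadj)).not_gt hadj.adjustmentRank_lt

/-! ### Weak network payoffs -/

theorem disagree_subset_of_reflTransGen {E : Environment V P} {q : V → ℝ≥0 → Ω → ℝ} {t : ℝ≥0}
    {ω : Ω} {x y : (V → Fin 2) × Set V} (h : Relation.ReflTransGen (Adjust E q t ω) x y)
    (hx : disagree E x.1 ⊆ x.2) : disagree E y.1 ⊆ y.2 := by
  induction h with
  | refl => exact hx
  | tail _ hadj _ =>
    obtain ⟨i, _, _, h2⟩ := hadj
    exact h2 ▸ Set.subset_union_right

/-- An informed agent who plays the worse action while a strong neighbour plays the better one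
could gain by switching. -/
theorem not_mutualBestReply_of_adj {E : Environment V P} (hτ : (E.τ : ℝ) * E.dMax ≤ 1)
    {q : V → ℝ≥0 → Ω → ℝ} {t : ℝ≥0} {ω : Ω} {b : V → Fin 2} {K : Set V} {i j : V} (hi : i ∈ K)
    (hij : E.strong.Adj i j) (hbi : b i ≠ E.better t ω) (hbj : b j = E.better t ω) :
    ¬ MutualBestReply E q t ω b K := by
  classical
  intro h
  have hbr := h i (E.better t ω)
  have hone : 1 ≤ E.agreement b i (E.better t ω) := hbj ▸ E.one_le_agreement hij
  have hdeg : (E.strong.degree i : ℝ) ≤ E.dMax := by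
    unfold Environment.dMax
    exact_mod_cast (E.strong.degree_le_maxDegree i)
  have hsum := E.agreement_zero_add_one b i
  have hnn : (0 : ℝ) ≤ E.τ := E.τ.2
  rw [Fin.eq_one_sub_of_ne hbi] at hbr
  unfold belief at hbr
  generalize E.better t ω = y at hbr hone
  -- `τ * (agreement with the worse action) ≥ 1 + τ`, although `τ * degree ≤ 1`
  obtain rfl | rfl := Fin.eq_zero_or_one_of_two y
  all_goals
    simp [hi, Environment.expectedPayoff, Environment.material] at hbr
    nlinarith [mul_le_mul_of_nonneg_left hdeg hnn, mul_le_mul_of_nonneg_left hone hnn]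

theorem IsBNE.eq_of_adj {E : Environment V P} (hτ : (E.τ : ℝ) * E.dMax ≤ 1) {X : Play V Ω}
    {q : V → ℝ≥0 → Ω → ℝ} {t : ℝ≥0} {ω : Ω} {c b : V → Fin 2} (h : IsBNE E X q t ω c b) {i j : V}
    (hij : E.strong.Adj i j) : b i = b j := by
  obtain ⟨K, hreach, hbr⟩ := h
  have hK : disagree E b ⊆ K := disagree_subset_of_reflTransGen hreach
    fun i hi => Or.inl (Or.inr hi)
  by_contra hne
  have hi : i ∈ K := hK ⟨j, hij, hne⟩
  have hj : j ∈ K := hK ⟨i, hij.symm, Ne.symm hne⟩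
  by_cases hy : b j = E.better t ω
  · exact not_mutualBestReply_of_adj hτ hi hij (fun h => hne (h.trans hy.symm)) hy hbr
  · refine not_mutualBestReply_of_adj hτ hj hij.symm hy ?_ hbr
    rw [Fin.eq_one_sub_of_ne hne, Fin.eq_one_sub_of_ne (Ne.symm hy)]

theorem IsBNE.eq_of_reachable {E : Environment V P} (hτ : (E.τ : ℝ) * E.dMax ≤ 1) {X : Play V Ω}
    {q : V → ℝ≥0 → Ω → ℝ} {t : ℝ≥0} {ω : Ω} {c b : V → Fin 2} (h : IsBNE E X q t ω c b) {i j : V}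
    (hij : E.strong.Reachable i j) : b i = b j := by
  obtain ⟨w⟩ := hij
  induction w with
  | nil => rfl
  | cons hadj _ ih => exact (h.eq_of_adj hτ hadj).trans ih

/-! ### Strong network payoffs: Action `0` is never left -/

theorem expectedPayoff_zero_lt {E : Environment V P} (hτ : 1 < (E.τ : ℝ) * E.dMin) {p : ℝ}
    (hp : p ∈ Set.Icc (0 : ℝ) 1) (i : V) :
    E.expectedPayoff p (fun _ => 0) i 1 < E.expectedPayoff p (fun _ => 0) i 0 := by
  classical
  have hdeg : (E.dMin : ℝ) ≤ E.strong.degree i := by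
    unfold Environment.dMin
    exact_mod_cast (E.strong.minDegree_le_degree i)
  have h1 : E.agreement (fun _ => 0) i 1 = 0 := by simp [Environment.agreement]
  have hsum := E.agreement_zero_add_one (fun _ => 0) i
  have hnn : (0 : ℝ) ≤ E.τ := E.τ.2
  rw [h1, add_zero] at hsum
  simp only [Environment.expectedPayoff, Environment.material, h1, hsum]
  have := mul_le_mul_of_nonneg_left hdeg hnn
  norm_num
  linarith [hp.1, hp.2]

theorem not_adjust_zero {E : Environment V P} (hτ : 1 < (E.τ : ℝ) * E.dMin) {X : Play V Ω}
    {q : V → ℝ≥0 → Ω → ℝ} (hq : IsBayesBelief E X q) {t : ℝ≥0} {ω : Ω} {K : Set V}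
    {y : (V → Fin 2) × Set V} : ¬ Adjust E q t ω (fun _ => 0, K) y := by
  rintro ⟨i, hlt, -, -⟩
  exact (expectedPayoff_zero_lt hτ (belief_mem_Icc hq t ω K i) i).not_gt hlt

theorem mutualBestReply_zero {E : Environment V P} (hτ : 1 < (E.τ : ℝ) * E.dMin) {X : Play V Ω}
    {q : V → ℝ≥0 → Ω → ℝ} (hq : IsBayesBelief E X q) (t : ℝ≥0) (ω : Ω) (K : Set V) :
    MutualBestReply E q t ω (fun _ => 0) K := by
  intro i x
  obtain rfl | rfl := Fin.eq_zero_or_one_of_two x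
  · exact le_rfl
  · exact (expectedPayoff_zero_lt hτ (belief_mem_Icc hq t ω K i) i).le

theorem IsBNEWith.eq_zero {E : Environment V P} (hτ : 1 < (E.τ : ℝ) * E.dMin) {X : Play V Ω}
    {q : V → ℝ≥0 → Ω → ℝ} (hq : IsBayesBelief E X q) {t : ℝ≥0} {ω : Ω} {b : V → Fin 2} {K : Set V}
    (h : IsBNEWith E X q t ω (fun _ => 0) b K) : b = fun _ => 0 := by
  rcases h.1.cases_head with heq | ⟨y, hy, -⟩
  · exact (congrArg Prod.fst heq).symm
  · exact absurd hy (not_adjust_zero hτ hq)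

/-- A right-continuous step function is constant if it keeps its initial value `a` at every time
before which it has always been `a`. -/
theorem eq_const_of_right_of_left {α : Type*} {f : ℝ≥0 → α} {a : α} (h0 : f 0 = a)
    (hright : ∀ t, ∀ᶠ s in 𝓝[>] t, f s = f t)
    (hleft : ∀ t > 0, (∀ s < t, f s = a) → f t = a) (t : ℝ≥0) : f t = a := by
  by_contra hne
  set B : Set ℝ≥0 := {s | f s ≠ a} with hB
  have hbelow : ∀ s < sInf B, f s = a := fun s hs => by
    by_contra h
    exact (csInf_le (OrderBot.bddBelow B) h).not_gt hs
  have hinf : f (sInf B) = a := by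
    rcases eq_or_lt_of_le (zero_le (a := sInf B)) with h | h
    · rw [← h, h0]
    · exact hleft _ h hbelow
  obtain ⟨u, hu, hsub⟩ := (mem_nhdsGT_iff_exists_Ioo_subset).1 (hright (sInf B))
  obtain ⟨s, hs, hsu⟩ := exists_lt_of_csInf_lt ⟨t, hne⟩ (show sInf B < u from hu)
  rcases eq_or_lt_of_le (csInf_le (OrderBot.bddBelow B) hs) with h | h
  · exact hs (h ▸ hinf)
  · exact hs ((hsub ⟨h, hsu⟩ : f s = f (sInf B)).trans hinf)

theorem IsEquilibriumPlay.ae_act_eq_zero {E : Environment V P} (hτ : 1 < (E.τ : ℝ) * E.dMin)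
    {X : Play V Ω} {q : V → ℝ≥0 → Ω → ℝ} (h : IsEquilibriumPlay E X q) :
    ∀ᵐ ω ∂P, ∀ t, X.act t ω = fun _ => 0 := by
  filter_upwards [h.initial, h.right_cont, h.equilibrium] with ω hinit hright heq
  refine eq_const_of_right_of_left (f := fun t => X.act t ω) (funext hinit.1) hright ?_
  intro t ht hbefore
  obtain ⟨c, hc, -, hbne⟩ := heq t ht
  have : (𝓝[<] t).NeBot := nhdsLT_neBot_of_exists_lt ⟨0, ht⟩
  obtain ⟨s, hs, hst⟩ := (hc.and self_mem_nhdsWithin).exists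
  obtain rfl : c = fun _ => 0 := hs.symm.trans (hbefore s hst)
  exact hbne.eq_zero hτ h.bayes

/-! ### Strong network payoffs: the constant play is an equilibrium play -/

/-- The play in which everybody always intends Action `0`. No weak link is ever activated, and
information arrives for `i` when she or a strong neighbour trembles; time `0`, at which a tremble
has probability zero, is left out because an equilibrium play starts without news. -/
def zeroPlay (E : Environment V P) : Play V Ω where
  act _ _ _ := 0
  links _ _ := ∅
  news t ω := {i | t ≠ 0 ∧ ∃ j, (j = i ∨ E.strong.Adj i j) ∧ E.Trembles t ω j}

theorem measurable_tick (E : Environment V P) (c : Clock V) (k : ℕ) : Measurable (E.tick c k) := by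
  unfold Environment.tick
  exact (Finset.measurable_sum _ fun j _ => (E.measurable_gap c j).ennreal_ofReal).div_const _

/-- The action that is better at a random time is a random variable. Infinitely many shocks up to
that time count as none, because of the convention for `Set.ncard`. -/
theorem measurableSet_coin_ncard (E : Environment V P) {T : Ω → ℝ≥0∞} (hT : Measurable T)
    (x : Fin 2) :
    MeasurableSet {ω | E.coin (Set.ncard {k : ℕ | E.tick .shock k ω ≤ T ω}) ω = x} := by
  have hN : Measurable fun ω => Set.ncard {k : ℕ | E.tick .shock k ω ≤ T ω} := by
    have hS : Measurable fun ω => {k : ℕ | E.tick .shock k ω ≤ T ω} :=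
      measurable_set_iff.2 fun k => measurableSet_setOfPred.1
        (measurableSet_le (measurable_tick E _ k) hT)
    exact measurable_ncard.comp hS
  have : {ω | E.coin (Set.ncard {k : ℕ | E.tick .shock k ω ≤ T ω}) ω = x} =
      ⋃ n, {ω | Set.ncard {k : ℕ | E.tick .shock k ω ≤ T ω} = n} ∩ {ω | E.coin n ω = x} := by
    ext ω; simp
  rw [this]
  exact MeasurableSet.iUnion fun n => (hN (measurableSet_singleton n)).inter
    (E.measurable_coin n (measurableSet_singleton x))

theorem measurableSet_exists_trembles (E : Environment V P) (u v : ℝ≥0) (j : V) :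
    MeasurableSet {ω | ∃ s, u ≤ s ∧ s < v ∧ E.Trembles s ω j} := by
  have : {ω | ∃ s, u ≤ s ∧ s < v ∧ E.Trembles s ω j} =
      ⋃ k, E.tick .tremble k ⁻¹' Set.Ico (u : ℝ≥0∞) v ∩ {ω | E.trembler k ω = j} := by
    ext ω
    simp only [Set.mem_ofPred_eq, Set.mem_iUnion, Set.mem_inter_iff, Set.mem_preimage, Set.mem_Ico,
      Environment.Trembles]
    constructor
    · rintro ⟨s, hu, hv, k, hk, hj⟩
      exact ⟨k, ⟨by rw [hk]; exact_mod_cast hu, by rw [hk]; exact_mod_cast hv⟩, hj⟩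
    · rintro ⟨k, ⟨hu, hv⟩, hj⟩
      lift E.tick .tremble k ω to ℝ≥0 using hv.ne_top with s hs
      exact ⟨s, by exact_mod_cast hu, by exact_mod_cast hv, k, hs.symm, hj⟩
  rw [this]
  exact MeasurableSet.iUnion fun k =>
    (measurable_tick E _ k measurableSet_Ico).inter (E.measurable_trembler k j)

theorem measurableSet_exists_news_zeroPlay (E : Environment V P) (u v : ℝ≥0) (i : V) (x : Fin 2) :
    MeasurableSet {ω | ∃ s, u ≤ s ∧ s < v ∧ i ∈ (zeroPlay E).news s ω ∧ E.better s ω = x} := by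
  have : {ω | ∃ s, u ≤ s ∧ s < v ∧ i ∈ (zeroPlay E).news s ω ∧ E.better s ω = x} =
      ⋃ j : {j // j = i ∨ E.strong.Adj i j}, ⋃ k,
        E.tick .tremble k ⁻¹' (Set.Ico (u : ℝ≥0∞) v ∩ {0}ᶜ) ∩ {ω | E.trembler k ω = j} ∩
        {ω | E.coin (Set.ncard {l : ℕ | E.tick .shock l ω ≤ E.tick .tremble k ω}) ω = x} := by
    ext ω
    simp only [Set.mem_ofPred_eq, Set.mem_iUnion, Set.mem_inter_iff, Set.mem_preimage, Set.mem_Ico,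
      Environment.Trembles, zeroPlay, Environment.better, Set.mem_compl_iff, Set.mem_singleton_iff]
    constructor
    · rintro ⟨s, hu, hv, ⟨hs0, j, hij, k, hk, hj⟩, hx⟩
      exact ⟨⟨j, hij⟩, k, ⟨⟨⟨by rw [hk]; exact_mod_cast hu, by rw [hk]; exact_mod_cast hv⟩,
        by rw [hk]; exact_mod_cast hs0⟩, hj⟩, by rw [hk]; exact hx⟩
    · rintro ⟨⟨j, hij⟩, k, ⟨⟨⟨hu, hv⟩, h0⟩, hj⟩, hx⟩
      obtain ⟨s, hs⟩ : ∃ s : ℝ≥0, (s : ℝ≥0∞) = E.tick .tremble k ω := ⟨_, ENNReal.coe_toNNReal hv.ne_top⟩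
      rw [← hs] at hu hv h0 hx
      exact ⟨s, by exact_mod_cast hu, by exact_mod_cast hv,
        ⟨by exact_mod_cast h0, j, hij, k, hs.symm, hj⟩, hx⟩
  rw [this]
  exact MeasurableSet.iUnion fun j => MeasurableSet.iUnion fun k =>
    ((measurable_tick E _ k (measurableSet_Ico.inter (measurableSet_singleton 0).compl)).inter
      (E.measurable_trembler k j)).inter (measurableSet_coin_ncard E (measurable_tick E _ k) x)

theorem isMeasurablePlay_zeroPlay (E : Environment V P) : IsMeasurablePlay E (zeroPlay E) := by
  intro i t
  refine MeasurableSpace.generateFrom_le ?_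
  rintro _ ⟨o, u, v, -, rfl⟩
  cases o with
  | action j x =>
    -- the intended actions do not depend on the state of the world
    exact MeasurableSet.const (∃ s, u ≤ s ∧ s < v ∧ (j = i ∨ E.strong.Adj i j) ∧ 0 = x)
  | tremble j =>
    by_cases hij : j = i ∨ E.strong.Adj i j
    · simpa only [Observes, hij, true_and] using measurableSet_exists_trembles E u v j
    · simp [Observes, hij]
  | activation e => simp [Observes, zeroPlay]
  | payoff x => exact measurableSet_exists_news_zeroPlay E u v i x

theorem activated_zero (E : Environment V P) (X : Play V Ω) (t : ℝ≥0) (ω : Ω) :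
    activated E X t ω (fun _ => 0) = ∅ := by
  ext e
  simp [activated, eligible]

/-- An agent sees a realised disagreement with a neighbour exactly if one of the two trembles and
the other does not, so news arrives when she or a neighbour trembles. -/
theorem news_zeroPlay (E : Environment V P) {t : ℝ≥0} (ht : t ≠ 0) (ω : Ω) :
    (zeroPlay E).news t ω = arrivals E (zeroPlay E) t ω (fun _ => 0) := by
  ext i
  simp only [arrivals, activated_zero, disagree, realised, zeroPlay, Set.mem_union,
    Set.mem_ofPred_eq]
  constructor
  · rintro ⟨-, j, rfl | hij, hj⟩
    · simp [hj]
    · by_cases hi : E.Trembles t ω i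
      · simp [hi]
      · exact Or.inr ⟨j, hij, by simp [hi, hj]⟩
  · rintro (((hi | ⟨e, he, -⟩) | ⟨j, -, hj⟩) | ⟨j, hij, hj⟩)
    · exact ⟨ht, i, Or.inl rfl, hi⟩
    · exact he.elim
    · exact absurd rfl hj
    · by_cases hi : E.Trembles t ω i
      · exact ⟨ht, i, Or.inl rfl, hi⟩
      · by_cases hj' : E.Trembles t ω j
        · exact ⟨ht, j, Or.inr hij, hj'⟩
        · simp [hi, hj'] at hj

theorem isEquilibriumPlay_zeroPlay {E : Environment V P} (hτ : 1 < (E.τ : ℝ) * E.dMin)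
    {q : V → ℝ≥0 → Ω → ℝ} (hq : IsBayesBelief E (zeroPlay E) q) :
    IsEquilibriumPlay E (zeroPlay E) q where
  measurable := isMeasurablePlay_zeroPlay E
  bayes := hq
  initial := Eventually.of_forall fun ω => ⟨fun _ => rfl, rfl, by simp [zeroPlay]⟩
  right_cont := Eventually.of_forall fun ω t => Eventually.of_forall fun s => rfl
  equilibrium := Eventually.of_forall fun ω t ht =>
    ⟨fun _ => 0, Eventually.of_forall fun s => rfl, (activated_zero E _ t ω).symm,
      by rw [news_zeroPlay E ht.ne' ω]; exact .refl, mutualBestReply_zero hτ hq t ω _⟩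

end Auxiliary

theorem theorem1 {V : Type*} [Fintype V] {Ω : Type*} [MeasurableSpace Ω] (P : Measure Ω)
    [IsProbabilityMeasure P] (E : Environment V P) :
    -- existence of Bayesian beliefs and of an equilibrium, at every time and after every history
    (∀ X : Play V Ω, IsMeasurablePlay E X →
      (∃ q : V → ℝ≥0 → Ω → ℝ, IsBayesBelief E X q) ∧
      ∀ q : V → ℝ≥0 → Ω → ℝ, IsBayesBelief E X q →
        ∀ (t : ℝ≥0) (ω : Ω) (c : V → Fin 2), ∃ b, IsBNE E X q t ω c b) ∧
    -- weak network payoffs: agents joined by a path of strong links act alike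
    ((E.τ : ℝ≥0∞) ≤ 1 / (E.dMax : ℝ≥0∞) →
      (∀ (X : Play V Ω) (q : V → ℝ≥0 → Ω → ℝ), IsMeasurablePlay E X → IsBayesBelief E X q →
        ∀ (t : ℝ≥0) (ω : Ω) (c b : V → Fin 2), IsBNE E X q t ω c b →
          ∀ i j, E.strong.Reachable i j → b i = b j) ∧
      (∀ (X : Play V Ω) (q : V → ℝ≥0 → Ω → ℝ), IsEquilibriumPlay E X q →
        ∀ᵐ ω ∂P, ∀ (t : ℝ≥0) (i j : V), E.strong.Reachable i j → X.act t ω i = X.act t ω j)) ∧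
    -- strong network payoffs: everybody keeps playing Action 0
    (1 / (E.dMin : ℝ≥0∞) < (E.τ : ℝ≥0∞) →
      (∃ (X : Play V Ω) (q : V → ℝ≥0 → Ω → ℝ), IsEquilibriumPlay E X q) ∧
      (∀ (X : Play V Ω) (q : V → ℝ≥0 → Ω → ℝ), IsEquilibriumPlay E X q →
        ∀ᵐ ω ∂P, ∀ (t : ℝ≥0) (i : V), X.act t ω i = 0) ∧
      (E.dMax = E.dMin → ∀ (X : Play V Ω) (q : V → ℝ≥0 → Ω → ℝ), IsEquilibriumPlay E X q →
        ∀ᵐ ω ∂P, ∀ (t : ℝ≥0) (i j : V), X.act t ω i = X.act t ω j)) := by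
  refine ⟨fun X hX => ⟨exists_isBayesBelief E X hX, fun q _ t ω c => exists_isBNE E X q t ω c⟩,
    fun h => ?_, fun h => ?_⟩
  · -- for `dMax = 0` the bound on `τ` is infinite, and the product vanishes
    have hτ : (E.τ : ℝ) * E.dMax ≤ 1 := by
      rw [ENNReal.le_div_iff_mul_le (by simp) (by simp)] at h
      exact_mod_cast h
    refine ⟨fun X q _ _ t ω c b hb i j hij => hb.eq_of_reachable hτ hij, fun X q hX => ?_⟩
    filter_upwards [hX.initial, hX.equilibrium] with ω hinit heq t i j hij
    rcases eq_or_lt_of_le (zero_le (a := t)) with rfl | ht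
    · rw [hinit.1 i, hinit.1 j]
    · obtain ⟨c, -, -, hb⟩ := heq t ht
      exact IsBNE.eq_of_reachable hτ ⟨_, hb⟩ hij
  · have hτ : 1 < (E.τ : ℝ) * E.dMin := by
      rw [ENNReal.div_lt_iff (by simp) (by simp)] at h
      exact_mod_cast h
    refine ⟨?_, fun X q hX => ?_, fun _ X q hX => ?_⟩
    · obtain ⟨q, hq⟩ := exists_isBayesBelief E (zeroPlay E) (isMeasurablePlay_zeroPlay E)
      exact ⟨zeroPlay E, q, isEquilibriumPlay_zeroPlay hτ hq⟩
    · filter_upwards [hX.ae_act_eq_zero hτ] with ω hω t i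
      rw [hω t]
    · filter_upwards [hX.ae_act_eq_zero hτ] with ω hω t i j
      rw [hω t]
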